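/- Let $F$ be a differential field of characteristic zero whose field of constants is algebraically closed. Let $E$ be an iterated antiderivative extension of $F$, i.e. a differential field extension of $F$ having the same constants as $F$ and such that $E=F(\zeta_1,\dots,\zeta_n)$ for finitely many elements $\zeta_1,\dots,\zeta_n\in E$ ($n\ge 0$) with $\zeta_i'\in F(\zeta_1,\dots,\zeta_{i-1})$ for every $i$ (so $\zeta_1'\in F$). Let $K$ be a differential field with $F\subsetneq K\subseteq E$ that is a minimal differential field extension of $F$, i.e. every differential field $M$ with $F\subseteq M\subseteq K$ is equal to $F$ or to $K$. Then there is an element $\zeta\in E$ with $\zeta'\in F$ (an antiderivative of $F$) such that $K=F(\zeta)$. -/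

import Mathlib

open scoped Differential

namespace DiffField

/-- The field of constants of a differential field: the kernel of the derivation. -/
def constants (F : Type*) [Field F] [Differential F] : Subfield F where
  carrier := {x | x′ = 0}
  mul_mem' := by
    intro a b ha hb
    simp only [Set.mem_ofPred_eq] at ha hb ⊢
    simp [Derivation.leibniz, ha, hb]
  one_mem' := by simp
  add_mem' := by
    intro a b ha hb
    simp only [Set.mem_ofPred_eq] at ha hb ⊢
    simp [ha, hb]
  zero_mem' := by simp
  neg_mem' := by
    intro a ha
    simp only [Set.mem_ofPred_eq] at ha ⊢
    simp [ha]
  inv_mem' := by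
    intro a ha
    simp only [Set.mem_ofPred_eq] at ha ⊢
    simp [Derivation.leibniz_inv, ha]

section

variable (F : Type*) {E : Type*} [Field F] [Field E] [Differential E] [Algebra F E]

/-- `ζ ∈ E` is an antiderivative of (an element of) `F`: its derivative lies in `F`. -/
def IsAntiderivative (ζ : E) : Prop :=
  ∃ a : F, ζ′ = algebraMap F E a

/-- `ζ₁, …, ζₙ ∈ E` are iterated antiderivatives of `F`: the derivative of each `ζᵢ` lies in
the field generated over `F` by the preceding ones (in `F` itself for the first one). -/
def IsIteratedAntiderivatives {n : ℕ} (ζ : Fin n → E) : Prop :=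
  ∀ i : Fin n, (ζ i)′ ∈ IntermediateField.adjoin F (ζ '' {j | j < i})

variable (E) in
/-- `E` is an iterated antiderivative extension of `F`: it has no new constants, and it is
generated as a field over `F` by finitely many iterated antiderivatives of `F`. -/
def IsIteratedAntiderivativeExtension : Prop :=
  Differential.ContainConstants F E ∧
    ∃ (n : ℕ) (ζ : Fin n → E), IsIteratedAntiderivatives F ζ ∧
      IntermediateField.adjoin F (Set.range ζ) = ⊤

variable {F}

/-- The intermediate field `K` is a differential subfield of `E`. -/
def IsDifferentialSubfield (K : IntermediateField F E) : Prop :=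
  ∀ x ∈ K, x′ ∈ K

/-- `K` is a minimal differential field extension of `F`: a differential field strictly
containing `F` with no differential field strictly between `F` and `K`. (`⊥` is `F`.) -/
def IsMinimalDifferentialExtension (K : IntermediateField F E) : Prop :=
  IsDifferentialSubfield K ∧ ⊥ < K ∧
    ∀ M : IntermediateField F E, IsDifferentialSubfield M → M ≤ K → M = K ∨ M = ⊥

end

end DiffField

/-! It suffices to find in `K` an antiderivative `z` of `F` outside `F`: then `F(z)` is a
differential field and minimality forces `K = F(z)`. Such a `z` exists in every differential field
strictly above `F`, by descent along the tower defining `E` (`exists_antiderivative_of_adjoin`).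

For a step from `B(t)` down to `B`, with `t′ ∈ B` and `B < K`, only `t ∉ K` needs work. Then `t` is
transcendental over `K`, since there are no new constants, and `B(t) < K(t)`, so `K(t)` contains
some `η ∉ B(t)` with `η′ ∈ B(t)`. Expand `η` in powers of `1/t`. If `K` had no antiderivative of `B`
outside `B`, all coefficients would lie in `B`, one after the other, and a rational function over
`K` with such an expansion lies in `B(t)`: a contradiction (`mem_adjoin_of_deriv_mem_adjoin`). -/

namespace DiffField

/-! ### Expansion at infinity and descent of coefficients -/

section LaurentSeries

open Polynomial Differential

/-- A family of additive maps, acting on Laurent series coefficient by coefficient. -/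
def mapCoeffHom {K : Type*} [Field K] (δ : ℤ → K →+ K) : LaurentSeries K →+ LaurentSeries K where
  toFun x :=
    { coeff := fun i => δ i (x.coeff i)
      isPWO_support' := x.isPWO_support.mono fun i hi h => hi (by simp [h]) }
  map_zero' := by ext; simp
  map_add' x y := by ext; simp

@[simp]
theorem coeff_mapCoeffHom {K : Type*} [Field K] (δ : ℤ → K →+ K) (x : LaurentSeries K) (i : ℤ) :
    (mapCoeffHom δ x).coeff i = δ i (x.coeff i) := rfl

theorem mapCoeffHom_mul {K : Type*} [Field K] (δ : ℤ → K →+ K)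
    (hδ : ∀ i j x y, δ (i + j) (x * y) = δ i x * y + x * δ j y) (x y : LaurentSeries K) :
    mapCoeffHom δ (x * y) = mapCoeffHom δ x * y + x * mapCoeffHom δ y := by
  have hsupp (x : LaurentSeries K) : (mapCoeffHom δ x).support ⊆ x.support :=
    fun i hi h => hi (by simp [h])
  ext n
  rw [HahnSeries.coeff_add, HahnSeries.coeff_mul_right' y.isPWO_support (hsupp y),
    HahnSeries.coeff_mul_left' x.isPWO_support (hsupp x), coeff_mapCoeffHom,
    HahnSeries.coeff_mul, map_sum, ← Finset.sum_add_distrib]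
  refine Finset.sum_congr rfl fun ij hij => ?_
  rw [← (Finset.mem_antidiagonal.1 hij).2.2, hδ, coeff_mapCoeffHom, coeff_mapCoeffHom]

/-- The derivation of `K((1/t))` extending that of `K` with `t′ = a`. -/
noncomputable def laurentDeriv {K : Type*} [Field K] [Differential K] (a : K) :
    LaurentSeries K →+ LaurentSeries K :=
  mapCoeffHom (fun _ => (Differential.deriv : Derivation ℤ K K).toLinearMap.toAddMonoidHom) -
    (AddMonoidHom.mulLeft (HahnSeries.single 1 a)).comp
      (mapCoeffHom fun i => AddMonoidHom.mulLeft (i : K))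

theorem laurentDeriv_mul {K : Type*} [Field K] [Differential K] (a : K) (x y : LaurentSeries K) :
    laurentDeriv a (x * y) = laurentDeriv a x * y + x * laurentDeriv a y := by
  simp only [laurentDeriv, AddMonoidHom.sub_apply, AddMonoidHom.comp_apply,
    AddMonoidHom.coe_mulLeft]
  rw [mapCoeffHom_mul _ (fun i j x y => by simp [Derivation.leibniz]; ring),
    mapCoeffHom_mul _ (fun i j x y => by simp; ring)]
  ring

/-- Index `i` is the exponent of `u = 1/t`, and `u′ = -a u²`. Only the coefficients `i` and `i - 1`
enter, which makes induction on `i` possible. -/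
theorem coeff_laurentDeriv {K : Type*} [Field K] [Differential K] (a : K) (x : LaurentSeries K)
    (i : ℤ) :
    (laurentDeriv a x).coeff i = (x.coeff i)′ - a * ((i - 1 : ℤ) * x.coeff (i - 1)) := by
  simp [laurentDeriv, HahnSeries.coeff_single_mul]

/-- The embedding of `K[t]` into `K((1/t))`. -/
noncomputable def expandAtInfty (K : Type*) [Field K] : K[X] →+* LaurentSeries K :=
  eval₂RingHom HahnSeries.C (HahnSeries.single (-1) 1)

theorem expandAtInfty_monomial {K : Type*} [Field K] (n : ℕ) (c : K) :
    expandAtInfty K (monomial n c) = HahnSeries.single (-n : ℤ) c := by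
  simp [expandAtInfty, eval₂_monomial, HahnSeries.single_pow, HahnSeries.C_apply]

theorem coeff_expandAtInfty {K : Type*} [Field K] (p : K[X]) (n : ℕ) :
    (expandAtInfty K p).coeff (-n : ℤ) = p.coeff n := by
  induction p using Polynomial.induction_on' with
  | add p q hp hq => simp [hp, hq]
  | monomial m c =>
    rw [expandAtInfty_monomial, coeff_monomial, HahnSeries.coeff_single]
    simp [eq_comm]

theorem expandAtInfty_injective (K : Type*) [Field K] :
    Function.Injective (expandAtInfty K) := fun p q h => by
  ext n
  rw [← coeff_expandAtInfty, h, coeff_expandAtInfty]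

theorem laurentDeriv_expandAtInfty {K : Type*} [Field K] [Differential K] (a : K) (p : K[X]) :
    laurentDeriv a (expandAtInfty K p) = expandAtInfty K (implicitDeriv (C a) p) := by
  induction p using Polynomial.induction_on' with
  | add p q hp hq => simp [hp, hq]
  | monomial n c =>
    have h : implicitDeriv (C a) (monomial n c) =
        monomial n c′ + monomial (n - 1) (a * (c * n)) := by
      simp [implicitDeriv, derivative_monomial, C_mul_monomial]
    rw [h, map_add, expandAtInfty_monomial, expandAtInfty_monomial, expandAtInfty_monomial]
    ext i
    rw [coeff_laurentDeriv]
    simp only [HahnSeries.coeff_single, HahnSeries.coeff_add]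
    -- For `n = 0` the truncated `n - 1` is harmless, as its coefficient has the factor `n`; the
    -- index shift `e` needs `n > 0`.
    rcases n with _ | n
    · by_cases h0 : i = 0 <;> by_cases h1 : i = 1 <;> simp_all [sub_eq_zero]
    · have e : (i - 1 = -((n + 1 : ℕ) : ℤ)) ↔ (i = -((n + 1 - 1 : ℕ) : ℤ)) := by
        simp; omega
      simp only [e]
      by_cases h0 : i = -((n + 1 : ℕ) : ℤ) <;> by_cases h1 : i = -((n + 1 - 1 : ℕ) : ℤ)
      · omega
      · simp [h0]
      · subst h1
        simp
        ring
      · rw [if_neg h0, if_neg h1, if_neg h0, if_neg h1]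
        simp

/-- Extending scalars in Laurent series. -/
noncomputable def laurentMap (F K : Type*) [Field F] [Field K] [Algebra F K] :
    LaurentSeries F →+* LaurentSeries K where
  toFun x := x.map (algebraMap F K)
  map_zero' := by ext; simp
  map_one' := by ext i; by_cases h : i = 0 <;> simp [HahnSeries.coeff_one, h]
  map_add' x y := by ext; simp
  map_mul' x y := HahnSeries.map_mul (algebraMap F K : F →ₙ+* K)

@[simp]
theorem coeff_laurentMap {F K : Type*} [Field F] [Field K] [Algebra F K] (x : LaurentSeries F)
    (i : ℤ) : (laurentMap F K x).coeff i = algebraMap F K (x.coeff i) := rfl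

theorem laurentMap_expandAtInfty {F K : Type*} [Field F] [Field K] [Algebra F K] (p : F[X]) :
    laurentMap F K (expandAtInfty F p) = expandAtInfty K (p.map (algebraMap F K)) := by
  induction p using Polynomial.induction_on' with
  | add p q hp hq => simp [hp, hq]
  | monomial n c =>
    rw [map_monomial, expandAtInfty_monomial, expandAtInfty_monomial]
    ext i
    by_cases h : i = -(n : ℤ) <;> simp [h]

/-- Apply a linear functional to each coefficient of a polynomial. -/
noncomputable def polyFunctional {F K : Type*} [Field F] [Field K] [Algebra F K] (l : K →ₗ[F] F)
    (p : K[X]) : F[X] :=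
  ∑ i ∈ p.support, monomial i (l (p.coeff i))

@[simp]
theorem coeff_polyFunctional {F K : Type*} [Field F] [Field K] [Algebra F K] (l : K →ₗ[F] F)
    (p : K[X]) (n : ℕ) : (polyFunctional l p).coeff n = l (p.coeff n) := by
  by_cases h : p.coeff n = 0 <;> simp [polyFunctional, finsetSum_coeff, coeff_monomial, h]

/-- Since `g` has coefficients in `F`, multiplication by `g` commutes with the `F`-linear `l`.
Relations `g * Q = P` thus descend from `K` to `F`. -/
theorem coeff_mul_expandAtInfty_polyFunctional {F K : Type*} [Field F] [Field K] [Algebra F K]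
    (l : K →ₗ[F] F) (g : LaurentSeries F) (p : K[X]) (i : ℤ) :
    (g * expandAtInfty F (polyFunctional l p)).coeff i =
      l ((laurentMap F K g * expandAtInfty K p).coeff i) := by
  induction p using Polynomial.induction_on' with
  | add p q hp hq =>
    have h : polyFunctional l (p + q) = polyFunctional l p + polyFunctional l q := by ext; simp
    simp [h, mul_add, hp, hq]
  | monomial n c =>
    have h : polyFunctional l (monomial n c) = monomial n (l c) := by
      ext m
      by_cases h : n = m <;> simp [coeff_monomial, h]
    rw [h, expandAtInfty_monomial, expandAtInfty_monomial, HahnSeries.coeff_mul_single,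
      HahnSeries.coeff_mul_single, coeff_laurentMap, ← Algebra.smul_def, map_smul, smul_eq_mul]

/-- A quotient of polynomials over `K` whose expansion at infinity has coefficients in `F` is a
quotient of polynomials over `F`. -/
theorem exists_polynomial_of_laurentMap_mul_eq {F K : Type*} [Field F] [Field K] [Algebra F K]
    {g : LaurentSeries F} {P Q : K[X]} (hQ : Q ≠ 0)
    (h : laurentMap F K g * expandAtInfty K Q = expandAtInfty K P) :
    ∃ p q : F[X], q ≠ 0 ∧ P * q.map (algebraMap F K) = Q * p.map (algebraMap F K) := by
  obtain ⟨n, hn⟩ : ∃ n, Q.coeff n ≠ 0 := by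
    by_contra! H
    exact hQ (by ext n; simp [H n])
  -- Choosing `l` nonzero on a coefficient of `Q` keeps the new denominator nonzero.
  obtain ⟨l, hl⟩ := Module.Projective.exists_dual_ne_zero F hn
  have key : g * expandAtInfty F (polyFunctional l Q) = expandAtInfty F (polyFunctional l P) := by
    ext i
    rw [coeff_mul_expandAtInfty_polyFunctional, h]
    simpa using (coeff_mul_expandAtInfty_polyFunctional l 1 P i).symm
  refine ⟨polyFunctional l P, polyFunctional l Q, fun h0 => hl ?_, expandAtInfty_injective K ?_⟩
  · simpa using congrArg (fun p => p.coeff n) h0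
  · rw [map_mul, map_mul, ← laurentMap_expandAtInfty, ← laurentMap_expandAtInfty, ← key, ← h,
      map_mul]
    ring

/-- If no element of `K` outside `F` has its derivative in `F`, a Laurent series over `K` whose
derivative has coefficients in `F` has coefficients in `F`. -/
theorem exists_laurentMap_eq {F K : Type*} [Field F] [Field K] [Differential F] [Differential K]
    [Algebra F K] [DifferentialAlgebra F K]
    (hFK : ∀ z : K, z′ ∈ (algebraMap F K).range → z ∈ (algebraMap F K).range) (a : F)
    {f : LaurentSeries K} {r : LaurentSeries F}
    (h : laurentDeriv (algebraMap F K a) f = laurentMap F K r) :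
    ∃ g, laurentMap F K g = f := by
  -- The coefficient formula gives `fᵢ′ = rᵢ + a (i - 1) fᵢ₋₁`, which lies in `F`, so `hFK` applies
  -- to `fᵢ`.
  have step (i : ℤ) (hi : f.coeff (i - 1) ∈ (algebraMap F K).range) :
      f.coeff i ∈ (algebraMap F K).range := by
    refine hFK _ ?_
    have := congrArg (fun x => x.coeff i) h
    simp only [coeff_laurentDeriv, coeff_laurentMap, sub_eq_iff_eq_add] at this
    rw [this]
    exact add_mem ⟨_, rfl⟩ (mul_mem ⟨_, rfl⟩ (mul_mem ⟨((i - 1 : ℤ) : F), by simp⟩ hi))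
  have mem (i : ℤ) : f.coeff i ∈ (algebraMap F K).range := by
    rcases lt_or_ge i f.order with hi | hi
    · rw [HahnSeries.coeff_eq_zero_of_lt_order hi]
      exact zero_mem _
    · induction i, hi using Int.leInduction with
      | base =>
        refine step _ ?_
        rw [HahnSeries.coeff_eq_zero_of_lt_order (by omega)]
        exact zero_mem _
      | succ i _ ih => exact step _ (by simpa using ih)
  choose c hc using mem
  refine ⟨⟨c, f.isPWO_support.mono fun i hi h => hi ?_⟩, by ext i; exact hc i⟩
  exact (algebraMap F K).injective (by rw [hc, h, map_zero])

/-- Let `t` be transcendental over `K` with `t′ ∈ F`. If `K` contains no antiderivative of `F`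
outside `F`, then an element of `K(t)` with derivative in `F(t)` lies in `F(t)`. -/
theorem mem_adjoin_of_deriv_mem_adjoin {F K E : Type*} [Field F] [Field K] [Field E]
    [Differential F] [Differential K] [Differential E] [Algebra F K] [Algebra K E] [Algebra F E]
    [IsScalarTower F K E] [DifferentialAlgebra F K] [DifferentialAlgebra K E]
    (hFK : ∀ z : K, z′ ∈ (algebraMap F K).range → z ∈ (algebraMap F K).range)
    {t : E} (ht : Transcendental K t) {a : F} (hta : t′ = algebraMap F E a)
    {η : E} (hη : η ∈ IntermediateField.adjoin K {t})
    (hη' : η′ ∈ IntermediateField.adjoin F {t}) :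
    η ∈ IntermediateField.adjoin F {t} := by
  rcases eq_or_ne η 0 with rfl | hη0
  · exact zero_mem _
  obtain ⟨P, Q, rfl⟩ := (IntermediateField.mem_adjoin_simple_iff _ _).1 hη
  have hQt : aeval t Q ≠ 0 := fun h => hη0 (by simp [h])
  have hQ : Q ≠ 0 := fun h => hQt (by simp [h])
  obtain ⟨R, S, hRS⟩ : ∃ R S : F[X], S ≠ 0 ∧
      (aeval t P / aeval t Q : E)′ = aeval t R / aeval t S := by
    obtain ⟨R, S, h⟩ := (IntermediateField.mem_adjoin_simple_iff _ _).1 hη'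
    -- A zero denominator makes the quotient `0` by convention; rewrite it as `0 / 1`.
    rcases eq_or_ne S 0 with rfl | hS
    · exact ⟨0, 1, one_ne_zero, by simpa using h⟩
    · exact ⟨R, S, hS, h⟩
  obtain ⟨hS, hRS⟩ := hRS
  have hinj := transcendental_iff_injective.1 ht
  have hinjF : Function.Injective (Polynomial.map (algebraMap F K)) :=
    map_injective _ (algebraMap F K).injective
  have hD (p : K[X]) : (aeval t p)′ = aeval t (implicitDeriv (C (algebraMap F K a)) p) :=
    deriv_aeval_eq_implicitDeriv t _
      (by rw [hta, aeval_C, ← IsScalarTower.algebraMap_apply]) p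
  have hmap (p : F[X]) : aeval t p = aeval t (p.map (algebraMap F K)) :=
    (aeval_map_algebraMap K t p).symm
  have hSt : aeval t (S.map (algebraMap F K)) ≠ 0 := fun h =>
    hS (hinjF (hinj (by simpa using h)))
  -- The quotient rule with denominators cleared is an identity in `K[X]`, as `t` is transcendental;
  -- it can then be carried to Laurent series.
  have poly : (implicitDeriv (C (algebraMap F K a)) P * Q -
      P * implicitDeriv (C (algebraMap F K a)) Q) * S.map (algebraMap F K) =
      R.map (algebraMap F K) * Q ^ 2 := by
    refine hinj ?_
    rw [Derivation.leibniz_div, hD, hD, hmap R, hmap S, smul_eq_mul, smul_eq_mul, smul_eq_mul]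
      at hRS
    simp only [map_mul, map_sub, map_pow]
    field_simp at hRS
    linear_combination hRS
  have hφQ : expandAtInfty K Q ≠ 0 := fun h => hQ (expandAtInfty_injective K (by simpa using h))
  have hφS : expandAtInfty K (S.map (algebraMap F K)) ≠ 0 := fun h =>
    hS (hinjF (expandAtInfty_injective K (by simpa using h)))
  obtain ⟨g, hg⟩ := exists_laurentMap_eq hFK a (f := expandAtInfty K P / expandAtInfty K Q)
    (r := expandAtInfty F R / expandAtInfty F S) (by
      have h1 : expandAtInfty K P / expandAtInfty K Q * expandAtInfty K Q = expandAtInfty K P :=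
        div_mul_cancel₀ _ hφQ
      have h2 := congrArg (laurentDeriv (algebraMap F K a)) h1
      rw [laurentDeriv_mul, laurentDeriv_expandAtInfty, laurentDeriv_expandAtInfty] at h2
      have h3 := congrArg (expandAtInfty K) poly
      simp only [map_mul, map_sub, map_pow] at h3
      rw [map_div₀ (laurentMap F K), laurentMap_expandAtInfty, laurentMap_expandAtInfty, eq_div_iff hφS]
      refine mul_right_cancel₀ (pow_ne_zero 2 hφQ) ?_
      rw [← h3, ← h2]
      linear_combination (-(expandAtInfty K (implicitDeriv (C (algebraMap F K a)) Q) *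
        expandAtInfty K (S.map (algebraMap F K)))) * h1)
  obtain ⟨p, q, hq, hpq⟩ := exists_polynomial_of_laurentMap_mul_eq (g := g) (P := P) hQ
    (by rw [hg, div_mul_cancel₀ _ hφQ])
  have hqt : aeval t q ≠ 0 := fun h => hq (hinjF (hinj (by simpa using h)))
  refine (IntermediateField.mem_adjoin_simple_iff _ _).2 ⟨p, q, ?_⟩
  have := congrArg (aeval t) hpq
  rw [map_mul, map_mul, ← hmap, ← hmap] at this
  rw [div_eq_div_iff hQt hqt, this, mul_comm]

end LaurentSeries

/-! ### Antiderivatives and descent along towers of differential fields -/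

section Towers

open IntermediateField

variable {F E : Type*} [Field F] [Field E] [Algebra F E]

/-- If `t` is transcendental over `K ⊇ B`, then `K ∩ B(t) = B`. -/
theorem mem_of_mem_adjoin_of_transcendental {B K : IntermediateField F E} (hBK : B ≤ K) {t x : E}
    (ht : Transcendental K t) (hxK : x ∈ K) (hx : x ∈ adjoin B {t}) : x ∈ B := by
  open Polynomial in
  obtain ⟨r, s, h⟩ := (mem_adjoin_simple_iff _ _).1 hx
  let i : B →+* K := (inclusion hBK).toRingHom
  have hi (p : B[X]) : aeval t (p.map i) = aeval t p := by
    rw [aeval_def, aeval_def, eval₂_map]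
    rfl
  rcases eq_or_ne (aeval t s) 0 with hs | hs
  · rw [h, hs, div_zero]
    exact zero_mem _
  -- Clearing denominators gives `x s = r` in `K[X]`; any nonzero coefficient of `s` exhibits `x` as
  -- a quotient of elements of `B`.
  · have hpoly : C (⟨x, hxK⟩ : K) * s.map i = r.map i := by
      refine transcendental_iff_injective.1 ht ?_
      rw [map_mul, aeval_C, hi, hi]
      exact (eq_div_iff hs).1 h
    obtain ⟨n, hn⟩ : ∃ n, s.coeff n ≠ 0 := by
      by_contra! H
      exact hs (by rw [show s = 0 by ext n; simp [H n], map_zero])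
    have hc := congrArg (fun p => ((p.coeff n : K) : E)) hpoly
    simp only [coeff_C_mul, coeff_map, MulMemClass.coe_mul] at hc
    have hc : x * (s.coeff n : E) = r.coeff n := hc
    have hn : (s.coeff n : E) ≠ 0 := by simpa using hn
    rw [eq_div_of_mul_eq hn hc]
    exact div_mem (r.coeff n).2 (s.coeff n).2

variable [Differential E]

/-- The derivation of a differential subfield. -/
abbrev IsDifferentialSubfield.differential {K : IntermediateField F E}
    (hK : IsDifferentialSubfield K) : Differential K where
  deriv := Derivation.mk' (AddMonoidHom.toIntLinearMap
    { toFun := fun x => ⟨(x : E)′, hK x x.2⟩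
      map_zero' := by ext; simp
      map_add' := fun x y => by ext; simp }) fun x y => by
    ext
    simp [Derivation.leibniz]

theorem IsDifferentialSubfield.differentialAlgebra {K : IntermediateField F E}
    (hK : IsDifferentialSubfield K) :
    letI := hK.differential
    DifferentialAlgebra K E :=
  let := hK.differential
  ⟨fun _ => rfl⟩

variable [Differential F]

theorem isDifferentialSubfield_adjoin [DifferentialAlgebra F E] {S : Set E}
    (hS : ∀ x ∈ S, x′ ∈ adjoin F S) : IsDifferentialSubfield (adjoin F S) := fun x hx => by
  induction hx using adjoin_induction with
  | mem x hx => exact hS x hx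
  | algebraMap x =>
    rw [deriv_algebraMap]
    exact IntermediateField.algebraMap_mem _ _
  | add x y _ _ hx hy =>
    rw [map_add]
    exact add_mem hx hy
  | inv x hx hx' =>
    rw [Derivation.leibniz_inv]
    exact mul_mem (neg_mem (pow_mem (inv_mem hx) 2)) hx'
  | mul x y hx hy hx' hy' =>
    rw [Derivation.leibniz]
    exact add_mem (mul_mem hx hy') (mul_mem hy hx')

theorem IsDifferentialSubfield.adjoin_simple [DifferentialAlgebra F E] {K : IntermediateField F E}
    (hK : IsDifferentialSubfield K) {t : E} (ht : t′ ∈ K) :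
    IsDifferentialSubfield ((adjoin K {t}).restrictScalars F) := by
  let := hK.differential
  have := hK.differentialAlgebra
  refine isDifferentialSubfield_adjoin (F := K) fun x hx => ?_
  rw [Set.mem_singleton_iff.1 hx]
  exact IntermediateField.algebraMap_mem (adjoin K {t}) ⟨_, ht⟩

/-- In characteristic zero and without new constants, an algebraic antiderivative of `F` lies
in `F`. -/
theorem mem_range_of_isAlgebraic_of_deriv_mem [CharZero F] [DifferentialAlgebra F E]
    [Differential.ContainConstants F E] {t : E} (ht : IsAlgebraic F t)
    (ht' : IsAntiderivative F t) : t ∈ (algebraMap F E).range := by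
  open Polynomial Differential in
  obtain ⟨a, ha⟩ := ht'
  have hmonic := minpoly.monic ht.isIntegral
  have hpos := minpoly.natDegree_pos ht.isIntegral
  obtain ⟨n, hn⟩ := Nat.exists_eq_succ_of_ne_zero hpos.ne'
  have hn' : (n + 1 : F) ≠ 0 := by exact_mod_cast n.succ_ne_zero
  have hcoeff (i : ℕ) : (implicitDeriv (C a) (minpoly F t)).coeff i =
      ((minpoly F t).coeff i)′ + a * ((minpoly F t).coeff (i + 1) * (i + 1)) := by
    simp [implicitDeriv, coeff_derivative]
  have htop : (minpoly F t).coeff (n + 1) = 1 := by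
    rw [← Nat.succ_eq_add_one, ← hn]
    exact hmonic
  -- This polynomial vanishes at `t`, and its degree is below that of the minimal polynomial because
  -- the leading coefficient `1` has derivative `0`.
  have hzero : implicitDeriv (C a) (minpoly F t) = 0 := by
    by_contra h0
    refine (minpoly.degree_le_of_ne_zero F t h0 ?_).not_gt ?_
    · rw [← deriv_aeval_eq_implicitDeriv t _ (by simpa using ha), minpoly.aeval, map_zero]
    · rw [degree_eq_natDegree hmonic.ne_zero, hn, degree_lt_iff_coeff_zero]
      intro m hm
      rw [hcoeff, coeff_eq_zero_of_natDegree_lt (n := m + 1) (by omega)]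
      rcases hm.eq_or_lt with rfl | hm
      · simp [htop]
      · simp [coeff_eq_zero_of_natDegree_lt (n := m) (p := minpoly F t) (by omega)]
  have hc : ((minpoly F t).coeff n)′ + a * (n + 1) = 0 := by
    simpa [hzero, htop] using (hcoeff n).symm
  -- By `hc`, the derivative of `coeff n / (n + 1)` is `-a`, so this sum is a constant.
  obtain ⟨c, hc'⟩ : t + algebraMap F E ((minpoly F t).coeff n / (n + 1)) ∈
      (algebraMap F E).range := by
    refine mem_range_of_deriv_eq_zero F ?_
    rw [map_add, deriv_algebraMap, ha, ← map_add, Derivation.leibniz_div]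
    have h1 : (n + 1 : F)′ = 0 := by simp
    rw [h1, eq_neg_of_add_eq_zero_left hc]
    simp only [smul_eq_mul]
    rw [map_eq_zero]
    field_simp
    ring
  exact ⟨c - (minpoly F t).coeff n / (n + 1), by rw [map_sub, hc', add_sub_cancel_right]⟩

/-- `E` has no new constants over `K` either, so the algebraic case applies with base `K`. -/
theorem transcendental_of_deriv_mem [CharZero F] [DifferentialAlgebra F E]
    [Differential.ContainConstants F E] {K : IntermediateField F E}
    (hK : IsDifferentialSubfield K) {t : E} (ht : t ∉ K) (ht' : t′ ∈ K) :
    Transcendental K t := fun h => by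
  let := hK.differential
  have := hK.differentialAlgebra
  have : Differential.ContainConstants K E := ⟨fun {x} hx => by
    obtain ⟨c, rfl⟩ := mem_range_of_deriv_eq_zero F hx
    exact ⟨algebraMap F K c, rfl⟩⟩
  obtain ⟨y, rfl⟩ := mem_range_of_isAlgebraic_of_deriv_mem h ⟨⟨_, ht'⟩, rfl⟩
  exact ht y.2

/-- Descent along a simple antiderivative extension: if every differential field strictly
containing `B(t)` has an antiderivative of `B(t)` outside `B(t)`, then the same holds for `B`. -/
theorem exists_antiderivative_of_adjoin [CharZero F] [DifferentialAlgebra F E]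
    [Differential.ContainConstants F E] {B : IntermediateField F E}
    (hB : IsDifferentialSubfield B) {t : E} (ht : t′ ∈ B)
    (ih : ∀ K : IntermediateField F E, IsDifferentialSubfield K →
      (adjoin B {t}).restrictScalars F < K → ∃ z ∈ K, z ∉ (adjoin B {t}).restrictScalars F ∧
        z′ ∈ (adjoin B {t}).restrictScalars F)
    {K : IntermediateField F E} (hK : IsDifferentialSubfield K) (hBK : B < K) :
    ∃ z ∈ K, z ∉ B ∧ z′ ∈ B := by
  by_cases htK : t ∈ K
  · by_cases htB : t ∈ B
    · have h : (adjoin B {t}).restrictScalars F = B := by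
        rw [restrictScalars_adjoin_eq_sup, sup_eq_left, adjoin_simple_le_iff]
        exact htB
      rw [h] at ih
      exact ih K hK hBK
    · exact ⟨t, htK, htB, ht⟩
  by_contra! hne
  have htr := transcendental_of_deriv_mem hK htK (hBK.le ht)
  obtain ⟨x, hxK, hxB⟩ := SetLike.exists_of_lt hBK
  have hle : (adjoin B {t}).restrictScalars F ≤ (adjoin K {t}).restrictScalars F := by
    rw [restrictScalars_adjoin_eq_sup, restrictScalars_adjoin_eq_sup]
    exact sup_le_sup_right hBK.le _
  -- The inclusion is strict because `K ∩ B(t) = B`, while `x ∈ K` is outside `B`.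
  have hlt : (adjoin B {t}).restrictScalars F < (adjoin K {t}).restrictScalars F :=
    lt_of_le_of_ne hle fun h => hxB <| mem_of_mem_adjoin_of_transcendental hBK.le htr hxK <| by
      rw [← mem_restrictScalars F, h]
      exact IntermediateField.algebraMap_mem (adjoin K {t}) ⟨x, hxK⟩
  obtain ⟨η, hηK, hηB, hη'⟩ := ih _ (hK.adjoin_simple (hBK.le ht)) hlt
  let := hB.differential
  let := hK.differential
  have := hK.differentialAlgebra
  let : Algebra B K := (inclusion hBK.le).toRingHom.toAlgebra
  have : IsScalarTower B K E := .of_algebraMap_eq fun _ => rfl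
  have : DifferentialAlgebra B K := ⟨fun _ => rfl⟩
  refine hηB (mem_adjoin_of_deriv_mem_adjoin (F := B) (K := K) (fun z hz => ?_) htr
    (a := ⟨_, ht⟩) rfl hηK hη')
  obtain ⟨b, hb⟩ := hz
  have hzB : (z : E)′ ∈ B := by
    have : ((b : B) : E) = (z : E)′ := congrArg (fun w : K => (w : E)) hb
    rw [← this]
    exact b.2
  exact ⟨⟨z, by_contra fun h => hne z z.2 h hzB⟩, rfl⟩

/-- Descent along a finite tower of simple antiderivative extensions. -/
theorem exists_antiderivative_of_tower [CharZero F] [DifferentialAlgebra F E]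
    [Differential.ContainConstants F E] {n : ℕ} {T : ℕ → IntermediateField F E}
    (hT : ∀ m, IsDifferentialSubfield (T m)) (hn : T n = ⊤)
    (hsucc : ∀ m < n, ∃ t : E, t′ ∈ T m ∧ T (m + 1) = (adjoin (T m) {t}).restrictScalars F)
    {m : ℕ} (hm : m ≤ n) : ∀ K : IntermediateField F E, IsDifferentialSubfield K →
      T m < K → ∃ z ∈ K, z ∉ T m ∧ z′ ∈ T m := by
  induction hm using Nat.decreasingInduction with
  | self =>
    intro K _ h
    rw [hn] at h
    exact absurd h not_top_lt
  | of_succ m hm ih =>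
    intro K hK h
    obtain ⟨t, ht, hmt⟩ := hsucc m hm
    rw [hmt] at ih
    exact exists_antiderivative_of_adjoin (hT m) ht ih hK h

/-- Every differential field strictly containing `F` inside an iterated antiderivative extension
of `F` contains an antiderivative of `F` outside `F`. -/
theorem IsIteratedAntiderivativeExtension.exists_antiderivative [CharZero F]
    [DifferentialAlgebra F E] (hE : IsIteratedAntiderivativeExtension F E)
    {K : IntermediateField F E} (hK : IsDifferentialSubfield K) (hFK : ⊥ < K) :
    ∃ z ∈ K, z ∉ (⊥ : IntermediateField F E) ∧ IsAntiderivative F z := by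
  obtain ⟨hconst, n, ζ, hζ, htop⟩ := hE
  obtain ⟨T, hT⟩ : ∃ T : ℕ → IntermediateField F E,
      ∀ m, T m = adjoin F (ζ '' {j | (j : ℕ) < m}) := ⟨_, fun _ => rfl⟩
  have hdiff (m : ℕ) : IsDifferentialSubfield (T m) := by
    rw [hT]
    refine isDifferentialSubfield_adjoin ?_
    rintro _ ⟨j, hj, rfl⟩
    exact adjoin.mono F _ _ (Set.image_mono fun k hk => lt_trans (Fin.lt_def.1 hk) hj) (hζ j)
  have hset : {j : Fin n | (j : ℕ) < n} = Set.univ := Set.eq_univ_of_forall fun j => j.2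
  have hn : T n = ⊤ := by rw [hT, hset, Set.image_univ, htop]
  have hsucc (m : ℕ) (hm : m < n) :
      ∃ t : E, t′ ∈ T m ∧ T (m + 1) = (adjoin (T m) {t}).restrictScalars F := by
    refine ⟨ζ ⟨m, hm⟩, ?_, ?_⟩
    · rw [hT]
      exact hζ ⟨m, hm⟩
    · have hset : {j : Fin n | (j : ℕ) < m + 1} = {j : Fin n | (j : ℕ) < m} ∪ {⟨m, hm⟩} := by
        ext j
        simp [Fin.ext_iff, le_iff_eq_or_lt]
      rw [restrictScalars_adjoin_eq_sup, hT, hT, ← adjoin_union, hset, Set.image_union,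
        Set.image_singleton]
  have hbot : T 0 = ⊥ := by simp [hT]
  obtain ⟨z, hzK, hz, hz'⟩ :=
    exists_antiderivative_of_tower hdiff hn hsucc n.zero_le K hK (by rwa [hbot])
  rw [hbot] at hz hz'
  obtain ⟨a, ha⟩ := mem_bot.1 hz'
  exact ⟨z, hzK, hz, a, ha.symm⟩

end Towers
end DiffField

theorem mainTheorem2 {F E : Type*} [Field F] [CharZero F] [Differential F]
    [IsAlgClosed (DiffField.constants F)]
    [Field E] [Differential E] [Algebra F E] [DifferentialAlgebra F E]
    (hE : DiffField.IsIteratedAntiderivativeExtension F E)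
    (K : IntermediateField F E) (hK : DiffField.IsMinimalDifferentialExtension K) :
    ∃ ζ : E, DiffField.IsAntiderivative F ζ ∧ K = IntermediateField.adjoin F {ζ} := by
  obtain ⟨hKd, hFK, hmin⟩ := hK
  obtain ⟨z, hzK, hz, a, ha⟩ := hE.exists_antiderivative hKd hFK
  refine ⟨z, ⟨a, ha⟩, ?_⟩
  have hd : DiffField.IsDifferentialSubfield (IntermediateField.adjoin F {z}) :=
    DiffField.isDifferentialSubfield_adjoin fun x hx => by
      rw [Set.mem_singleton_iff.1 hx, ha]
      exact IntermediateField.algebraMap_mem _ _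
  rcases hmin _ hd (IntermediateField.adjoin_simple_le_iff.2 hzK) with h | h
  · exact h.symm
  · exact absurd (IntermediateField.adjoin_simple_eq_bot_iff.1 h) hz
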